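/- Let $n\ge 2$ and let $\Omega\subset\mathbb{R}^n$ be a bounded open set. For a real function $g$ on $\Omega$ write $g^-=\operatorname{ess\,inf}_\Omega g$ and $g^+=\operatorname{ess\,sup}_\Omega g$, and call $g$ log-Hölder continuous with constant $L>0$ if $|g(x)-g(y)|\le L/\log(e+1/|x-y|)$ for all $x\ne y$ in $\Omega$. Let $p:\Omega\to[1,\infty)$ be log-Hölder continuous with constant $L_p$ and $1\le p^-\le p^+<\infty$, and let $\alpha:\Omega\to\mathbb{R}$ be log-Hölder continuous with constant $L_\alpha$, with $\alpha^->0$ and $(\alpha p)^+<n$. Put $$p^\#_\alpha(x)=\frac{n\,p(x)}{n-\alpha(x)p(x)},\qquad I_{\alpha(\cdot)}f(x)=\int_\Omega\frac{|f(y)|}{|x-y|^{n-\alpha(x)}}\,dy .$$ Let $L^{p(\cdot)}(\Omega)$ be the space of measurable $f:\Omega\to\mathbb{R}$ with $\int_\Omega|f(y)|^{p(y)}\,dy<\infty$, and let $\|f\|_{p(\cdot)}=\inf\{\lambda>0:\int_\Omega|f(y)/\lambda|^{p(y)}\,dy\le 1\}$. Then there is a constant $c<\infty$, depending only on $n$,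 $\operatorname{diam}(\Omega)$, $\alpha^-$, $(\alpha p)^+$, $p^+$, $L_p$ and $L_\alpha$, such that for every $f\in L^{p(\cdot)}(\Omega)$ with $\|f\|_{p(\cdot)}\le 1$ and every $t>0$, $$\int_{\{x\in\Omega:\,I_{\alpha(\cdot)}f(x)>t\}}t^{\,p^\#_\alpha(x)}\,dx\;\le\; c\int_\Omega|f(y)|^{p(y)}\,dy+c\,\bigl|\{x\in\Omega:0<|f(x)|\le 1\}\bigr| .$$ -/

import Mathlib

open MeasureTheory Set
open scoped ENNReal NNReal

namespace VariableExponent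

/-- `ess sup` of a real function over `A` with respect to Lebesgue measure, as an extended real
(so that no junk values occur for unbounded functions). -/
noncomputable def essSupOn {n : ℕ} (A : Set (EuclideanSpace ℝ (Fin n)))
    (g : EuclideanSpace ℝ (Fin n) → ℝ) : EReal :=
  essSup (fun x => (g x : EReal)) (volume.restrict A)

/-- `ess inf` of a real function over `A` with respect to Lebesgue measure, as an extended real. -/
noncomputable def essInfOn {n : ℕ} (A : Set (EuclideanSpace ℝ (Fin n)))
    (g : EuclideanSpace ℝ (Fin n) → ℝ) : EReal :=
  essInf (fun x => (g x : EReal)) (volume.restrict A)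

/-- `g` is log-Hölder continuous on `U` with constant `L`. -/
def LogHolderOnWith {n : ℕ} (L : ℝ) (U : Set (EuclideanSpace ℝ (Fin n)))
    (g : EuclideanSpace ℝ (Fin n) → ℝ) : Prop :=
  0 < L ∧ ∀ x ∈ U, ∀ y ∈ U, x ≠ y →
    |g x - g y| ≤ L / Real.log (Real.exp 1 + 1 / dist x y)

/-- A variable exponent on `U`: a (Lebesgue) measurable function `p : U → [1, ∞)` with
`1 ≤ p⁻ ≤ p⁺ < ∞`. -/
structure IsVariableExponent {n : ℕ} (U : Set (EuclideanSpace ℝ (Fin n)))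
    (p : EuclideanSpace ℝ (Fin n) → ℝ) : Prop where
  aemeasurable : AEMeasurable p (volume.restrict U)
  one_le : ∀ x ∈ U, 1 ≤ p x
  one_le_essInf : 1 ≤ essInfOn U p
  essSup_lt_top : essSupOn U p < ⊤

/-- The modular `∫_U |f(x)|^{p(x)} dx`, with values in `[0, ∞]`. -/
noncomputable def modular {n : ℕ} (U : Set (EuclideanSpace ℝ (Fin n)))
    (p f : EuclideanSpace ℝ (Fin n) → ℝ) : ℝ≥0∞ :=
  ∫⁻ x in U, ENNReal.ofReal (|f x| ^ p x)

/-- Membership in the variable exponent Lebesgue space `L^{p(·)}(U)`. -/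
def MemVarLp {n : ℕ} (U : Set (EuclideanSpace ℝ (Fin n)))
    (p f : EuclideanSpace ℝ (Fin n) → ℝ) : Prop :=
  AEMeasurable f (volume.restrict U) ∧ modular U p f < ⊤

/-- The Luxemburg–Nakano norm `inf {l > 0 : modular (f / l) ≤ 1}`, with values in `[0, ∞]`. -/
noncomputable def luxemburgNorm {n : ℕ} (U : Set (EuclideanSpace ℝ (Fin n)))
    (p f : EuclideanSpace ℝ (Fin n) → ℝ) : ℝ≥0∞ :=
  ⨅ (l : ℝ) (_ : 0 < l) (_ : modular U p (fun x => f x / l) ≤ 1), ENNReal.ofReal l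

/-- The variable order Riesz potential `∫_Ω |f(y)| / |x - y|^{n - α(x)} dy`, in `[0, ∞]`. -/
noncomputable def rieszPotential {n : ℕ} (Ω : Set (EuclideanSpace ℝ (Fin n)))
    (α f : EuclideanSpace ℝ (Fin n) → ℝ) (x : EuclideanSpace ℝ (Fin n)) : ℝ≥0∞ :=
  ∫⁻ y in Ω, ‖f y‖ₑ / edist x y ^ ((n : ℝ) - α x)

/-- The Sobolev-type exponent `n p(x) / (n - α(x) p(x))`. -/
noncomputable def sharpExponent {n : ℕ} (α p : EuclideanSpace ℝ (Fin n) → ℝ)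
    (x : EuclideanSpace ℝ (Fin n)) : ℝ :=
  n * p x / (n - α x * p x)

end VariableExponent

open VariableExponent

namespace VariableExponent

open Metric

/-! Levels `t` are split at a threshold `T` that depends only on the data. For `t ≤ T`, Chebyshev's
inequality suffices: `t ^ p#(x)` is at most a constant times `t`, the potential maps `L¹` to `L¹`
because `Ω` is bounded, and `|f|` is at most `|f| ^ p` where `|f| > 1` and at most `1` where `0 <
|f| ≤ 1`. This is the source of the additive measure term. For `t > T`, the values `|f| ≤ 1`
contribute at most `t / 2` to the potential, so only the truncation `φ` with values in `{0} ∪ (1,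
∞)` matters. A variable exponent Jensen inequality (`setLIntegral_le_of_setLIntegral_rpow_le`) gives
Hedberg's estimate (`ExponentBounds.rieszPotential_le`). Its contrapositive gives each point `x` of
the superlevel set a ball of radius `ρ` with `∫ φ ^ p > s ^ p#(x) * ρ ^ n`, where `s` is comparable
to `t`. Vitali's covering lemma selects disjoint balls. Log-Hölder continuity of `p#` makes `s ^ p#`
essentially constant on each enlarged ball, since `s` is at most a constant times `ρ ^ (-n)`, and
summation gives the modular (`setLIntegral_rpow_sharpExponent_le`). -/

/-! ### Power integrals and the layer cake bound for Riesz kernels. -/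

theorem lintegral_Ioi_rpow_eq {q r : ℝ} (hq : 0 < q) (hr : 0 < r) :
    ∫⁻ ρ in Ioi r, ENNReal.ofReal (ρ ^ (-q - 1)) = ENNReal.ofReal (r ^ (-q) / q) := by
  rw [← ofReal_integral_eq_lintegral_ofReal (integrableOn_Ioi_rpow_of_lt (by linarith) hr)]
  · rw [integral_Ioi_rpow_of_lt (by linarith) hr, sub_add_cancel, neg_div_neg_eq]
  · filter_upwards [ae_restrict_mem measurableSet_Ioi] with ρ hρ
    exact Real.rpow_nonneg (hr.trans hρ).le _

theorem lintegral_Ioc_rpow_eq {q r : ℝ} (hq : 0 < q) (hr : 0 < r) :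
    ∫⁻ ρ in Ioc 0 r, ENNReal.ofReal (ρ ^ (q - 1)) = ENNReal.ofReal (r ^ q / q) := by
  have hi : IntervalIntegrable (fun ρ : ℝ => ρ ^ (q - 1)) volume 0 r :=
    intervalIntegral.intervalIntegrable_rpow' (by linarith)
  rw [← ofReal_integral_eq_lintegral_ofReal
    ((intervalIntegrable_iff_integrableOn_Ioc_of_le hr.le).1 hi)]
  · rw [← intervalIntegral.integral_of_le hr.le, integral_rpow (Or.inl (by linarith)),
      sub_add_cancel, Real.zero_rpow hq.ne', sub_zero]
  · filter_upwards [ae_restrict_mem measurableSet_Ioc] with ρ hρ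
    exact Real.rpow_nonneg hρ.1.le _

section LayerCake

variable {X : Type*} [MetricSpace X] [MeasurableSpace X] [BorelSpace X]
  [SecondCountableTopology X]

/-- Layer cake formula for the Riesz kernel. -/
theorem lintegral_edist_rpow_neg (μ : Measure X) [SFinite μ] {x : X} (hx : μ {x} = 0)
    {s : ℝ} (hs : 0 < s) :
    ∫⁻ y, edist x y ^ (-s) ∂μ
      = ∫⁻ ρ in Ioi (0 : ℝ), ENNReal.ofReal (s * ρ ^ (-s - 1)) * μ (ball x ρ) := by
  have hpt : ∀ᵐ y ∂μ, edist x y ^ (-s) = ∫⁻ ρ in Ioi (0 : ℝ),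
      ENNReal.ofReal (s * ρ ^ (-s - 1)) * {z : ℝ × X | dist z.2 x < z.1}.indicator 1 (ρ, y) := by
    have : ∀ᵐ y ∂μ, y ≠ x := by
      rw [ae_iff]; simpa using hx
    filter_upwards [this] with y hy
    have hd : 0 < dist y x := dist_pos.2 hy
    have h1 : ∀ ρ : ℝ, ENNReal.ofReal (s * ρ ^ (-s - 1)) *
        {z : ℝ × X | dist z.2 x < z.1}.indicator 1 (ρ, y)
        = (Ioi (dist y x)).indicator (fun ρ => ENNReal.ofReal (s * ρ ^ (-s - 1))) ρ := by
      intro ρ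
      by_cases h : dist y x < ρ <;> simp [indicator, h]
    simp_rw [h1]
    rw [setLIntegral_indicator measurableSet_Ioi,
      inter_eq_self_of_subset_left (Ioi_subset_Ioi hd.le)]
    simp_rw [ENNReal.ofReal_mul hs.le]
    rw [lintegral_const_mul _ (by fun_prop), lintegral_Ioi_rpow_eq hs hd,
      ← ENNReal.ofReal_mul hs.le, mul_div_cancel₀ _ hs.ne', edist_comm, edist_dist,
      ENNReal.ofReal_rpow_of_pos hd]
  rw [lintegral_congr_ae hpt, lintegral_lintegral_swap]
  · refine lintegral_congr fun ρ => ?_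
    have hm : MeasurableSet (ball x ρ) := measurableSet_ball
    rw [← lintegral_indicator_one hm, ← lintegral_const_mul _ (measurable_one.indicator hm)]
    refine lintegral_congr fun y => ?_
    by_cases h : dist y x < ρ <;> simp [indicator, h]
  · refine Measurable.aemeasurable ?_
    have hm : MeasurableSet {z : ℝ × X | dist z.2 x < z.1} :=
      measurableSet_lt (by fun_prop) (by fun_prop)
    have h2 : Measurable ({z : ℝ × X | dist z.2 x < z.1}.indicator (1 : ℝ × X → ℝ≥0∞)) :=
      measurable_one.indicator hm
    exact Measurable.mul (by fun_prop) (h2.comp measurable_swap)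

/-- Cut the layer cake integral at `r`: growth above the critical power `ρ ^ s` makes the part near
zero converge, growth below it the tail. It serves both Hedberg's argument, with `r` optimal, and
the integral of the kernel over `Ω`. -/
theorem lintegral_edist_rpow_neg_le (μ : Measure X) [SFinite μ] {x : X} (hx : μ {x} = 0)
    {s u v A A' r : ℝ} (hs : 0 < s) (hu : 0 < u) (hv : 0 < v) (hA : 0 ≤ A) (hA' : 0 ≤ A')
    (hr : 0 < r)
    (h₁ : ∀ ρ, 0 < ρ → ρ ≤ r → μ (ball x ρ) ≤ ENNReal.ofReal (A * ρ ^ (s + u)))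
    (h₂ : ∀ ρ, r < ρ → μ (ball x ρ) ≤ ENNReal.ofReal (A' * ρ ^ (s - v))) :
    ∫⁻ y, edist x y ^ (-s) ∂μ
      ≤ ENNReal.ofReal (s * (A * (r ^ u / u) + A' * (r ^ (-v) / v))) := by
  rw [lintegral_edist_rpow_neg μ hx hs, ← Ioc_union_Ioi_eq_Ioi hr.le]
  refine (lintegral_union_le _ _ _).trans ?_
  have e₁ : ∫⁻ ρ in Ioc 0 r, ENNReal.ofReal (s * ρ ^ (-s - 1)) * μ (ball x ρ)
      ≤ ENNReal.ofReal (s * A * (r ^ u / u)) := by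
    rw [ENNReal.ofReal_mul (by positivity), ← lintegral_Ioc_rpow_eq hu hr,
      ← lintegral_const_mul _ (by fun_prop)]
    refine setLIntegral_mono (by fun_prop) fun ρ hρ => ?_
    have h0 : 0 < ρ := hρ.1
    calc _ ≤ ENNReal.ofReal (s * ρ ^ (-s - 1)) * ENNReal.ofReal (A * ρ ^ (s + u)) := by
          gcongr; exact h₁ ρ hρ.1 hρ.2
      _ = _ := by
          rw [← ENNReal.ofReal_mul (by positivity), ← ENNReal.ofReal_mul (by positivity)]
          congr 1
          rw [show u - 1 = (-s - 1) + (s + u) by ring, Real.rpow_add h0 (-s - 1)]; ring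
  have e₂ : ∫⁻ ρ in Ioi r, ENNReal.ofReal (s * ρ ^ (-s - 1)) * μ (ball x ρ)
      ≤ ENNReal.ofReal (s * A' * (r ^ (-v) / v)) := by
    rw [ENNReal.ofReal_mul (by positivity), ← lintegral_Ioi_rpow_eq hv hr,
      ← lintegral_const_mul _ (by fun_prop)]
    refine setLIntegral_mono (by fun_prop) fun ρ hρ => ?_
    have h0 : 0 < ρ := hr.trans hρ
    calc _ ≤ ENNReal.ofReal (s * ρ ^ (-s - 1)) * ENNReal.ofReal (A' * ρ ^ (s - v)) := by
          gcongr; exact h₂ ρ hρ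
      _ = _ := by
          rw [← ENNReal.ofReal_mul (by positivity), ← ENNReal.ofReal_mul (by positivity)]
          congr 1
          rw [show -v - 1 = (-s - 1) + (s - v) by ring, Real.rpow_add h0 (-s - 1)]; ring
  refine (add_le_add e₁ e₂).trans_eq ?_
  rw [← ENNReal.ofReal_add (by positivity) (by positivity)]
  congr 1; ring

end LayerCake

/-! ### Log-Hölder continuity. -/

/-- The log-Hölder modulus compensates powers of the radius. -/
theorem rpow_le_of_abs_le_div_log {l K ρ δ L m : ℝ} (hl : 1 ≤ l) (hK : 1 ≤ K) (hρ : 0 < ρ)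
    (hm : 0 ≤ m) (hL : 0 ≤ L) (hlK : l ≤ K * ρ ^ (-m))
    (hδ : |δ| ≤ L / Real.log (Real.exp 1 + 1 / ρ)) :
    l ^ δ ≤ K ^ L * Real.exp (m * L) := by
  set w := Real.log (Real.exp 1 + 1 / ρ) with hw
  have h1ρ : 0 < 1 / ρ := by positivity
  have hw1 : 1 ≤ w := by
    rw [hw, Real.le_log_iff_exp_le (by positivity)]; linarith
  have hw2 : -Real.log ρ ≤ w := by
    rw [← Real.log_inv, hw, ← one_div]
    exact Real.log_le_log h1ρ (by linarith [Real.exp_pos 1])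
  have hlogK : 0 ≤ Real.log K := Real.log_nonneg hK
  have hlogl : 0 ≤ Real.log l := Real.log_nonneg hl
  -- `w ≥ 1` absorbs `log K` and `w ≥ -log ρ` absorbs the power of `ρ`; the resulting factor `w`
  -- cancels against the modulus `L / w`.
  have hll : Real.log l ≤ (Real.log K + m) * w := by
    calc Real.log l ≤ Real.log (K * ρ ^ (-m)) := Real.log_le_log (by linarith) hlK
      _ = Real.log K + m * (-Real.log ρ) := by
          rw [Real.log_mul (by positivity) (by positivity), Real.log_rpow hρ]; ring
      _ ≤ Real.log K * w + m * w := by gcongr; nlinarith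
      _ = _ := by ring
  have : Real.log l * δ ≤ Real.log K * L + m * L := by
    calc Real.log l * δ ≤ Real.log l * (L / w) := by
          gcongr; exact (le_abs_self _).trans hδ
      _ ≤ (Real.log K + m) * w * (L / w) := by gcongr
      _ = _ := by field_simp
  rw [Real.rpow_def_of_pos (by linarith), Real.rpow_def_of_pos (by linarith), ← Real.exp_add]
  exact Real.exp_le_exp.2 this

theorem LogHolderOnWith.abs_sub_le {n : ℕ} {L : ℝ} {U : Set (EuclideanSpace ℝ (Fin n))}
    {g : EuclideanSpace ℝ (Fin n) → ℝ} (h : LogHolderOnWith L U g)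
    {x y : EuclideanSpace ℝ (Fin n)} (hx : x ∈ U) (hy : y ∈ U) {ρ : ℝ} (hρ : 0 < ρ)
    (hd : dist x y ≤ ρ) :
    |g x - g y| ≤ L / Real.log (Real.exp 1 + 1 / ρ) := by
  have hpos : ∀ σ : ℝ, 0 < σ → 0 < Real.log (Real.exp 1 + 1 / σ) := fun σ hσ =>
    Real.log_pos (by
      have := Real.add_one_lt_exp one_ne_zero
      have : 0 < 1 / σ := by positivity
      linarith)
  rcases eq_or_ne x y with rfl | hne
  · rw [sub_self, abs_zero]
    exact div_nonneg h.1.le (hpos ρ hρ).le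
  · have hd0 : 0 < dist x y := dist_pos.2 hne
    refine (h.2 x hx y hy hne).trans ?_
    have := h.1
    have := hpos ρ hρ
    gcongr

theorem LogHolderOnWith.continuousOn {n : ℕ} {L : ℝ} {U : Set (EuclideanSpace ℝ (Fin n))}
    {g : EuclideanSpace ℝ (Fin n) → ℝ} (h : LogHolderOnWith L U g) : ContinuousOn g U := by
  intro x hx
  rw [Metric.continuousWithinAt_iff]
  intro ε hε
  have hL := h.1
  refine ⟨1 / Real.exp (2 * L / ε), by positivity, fun y hy hd => ?_⟩
  have h1 := h.abs_sub_le hy hx (by positivity) hd.le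
  rw [Real.dist_eq]
  refine h1.trans_lt ?_
  rw [one_div_one_div]
  have h2 : 2 * L / ε ≤ Real.log (Real.exp 1 + Real.exp (2 * L / ε)) := by
    rw [Real.le_log_iff_exp_le (by positivity)]
    linarith [Real.exp_pos 1]
  have h3 : 0 < 2 * L / ε := by positivity
  rw [div_lt_iff₀ (by linarith)]
  calc L < ε * (2 * L / ε) := by field_simp; linarith
    _ ≤ _ := by gcongr

/-- Pointwise bounds and regularity for a pair of exponents `p`, `α` on `Ω`. -/
structure ExponentBounds {n : ℕ} (Ω : Set (EuclideanSpace ℝ (Fin n)))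
    (p α : EuclideanSpace ℝ (Fin n) → ℝ) (a b P Lp Lα : ℝ) : Prop where
  two_le : 2 ≤ n
  measurableSet : MeasurableSet Ω
  one_le : ∀ x ∈ Ω, 1 ≤ p x
  le_P : ∀ x ∈ Ω, p x ≤ P
  a_pos : 0 < a
  a_le : ∀ x ∈ Ω, a ≤ α x
  mul_le : ∀ x ∈ Ω, α x * p x ≤ b
  b_lt : b < n
  logHolder_p : LogHolderOnWith Lp Ω p
  logHolder_α : LogHolderOnWith Lα Ω α

/-- The volume of the unit ball. -/
noncomputable def unitBallVolume (n : ℕ) : ℝ :=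
  (volume (ball (0 : EuclideanSpace ℝ (Fin n)) 1)).toReal

theorem unitBallVolume_nonneg (n : ℕ) : 0 ≤ unitBallVolume n := ENNReal.toReal_nonneg

theorem volume_closedBall_eq {n : ℕ} (x : EuclideanSpace ℝ (Fin n)) {ρ : ℝ} (hρ : 0 < ρ) :
    volume (closedBall x ρ) = ENNReal.ofReal (unitBallVolume n * ρ ^ n) := by
  rw [Measure.addHaar_closedBall _ _ hρ.le, finrank_euclideanSpace_fin, mul_comm,
    ENNReal.ofReal_mul (unitBallVolume_nonneg n), unitBallVolume,
    ENNReal.ofReal_toReal measure_ball_lt_top.ne]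

theorem rieszPotential_eq_lintegral_withDensity {n : ℕ} {Ω : Set (EuclideanSpace ℝ (Fin n))}
    {α f : EuclideanSpace ℝ (Fin n) → ℝ} (hf : AEMeasurable f (volume.restrict Ω))
    (x : EuclideanSpace ℝ (Fin n)) :
    rieszPotential Ω α f x = ∫⁻ y, edist x y ^ (-((n : ℝ) - α x))
      ∂((volume.restrict Ω).withDensity fun y => ‖f y‖ₑ) := by
  rw [lintegral_withDensity_eq_lintegral_mul₀ hf.enorm (by fun_prop), rieszPotential]
  refine lintegral_congr fun y => ?_
  rw [Pi.mul_apply, ENNReal.rpow_neg, div_eq_mul_inv]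

/-! ### Jensen's inequality with a variable exponent. -/

/-- A Jensen type inequality for variable exponents: a bound for the average of `φ ^ p` over a
ball transfers to a bound for the average of `φ`. -/
theorem setLIntegral_le_of_setLIntegral_rpow_le {n : ℕ} {Ω : Set (EuclideanSpace ℝ (Fin n))}
    (hΩ : MeasurableSet Ω) {p φ : EuclideanSpace ℝ (Fin n) → ℝ} {L K Y ρ : ℝ}
    (hp : ∀ x ∈ Ω, 1 ≤ p x) (hL : LogHolderOnWith L Ω p) (hφ : ∀ y, φ y = 0 ∨ 1 ≤ φ y)
    (hK : 1 ≤ K) (hρ : 0 < ρ) (hY : 0 < Y) (hYK : Y ≤ K * ρ ^ (-(n : ℝ)))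
    {x : EuclideanSpace ℝ (Fin n)} (hx : x ∈ Ω)
    (h : ∫⁻ y in closedBall x ρ ∩ Ω, ENNReal.ofReal (φ y ^ p y) ≤ ENNReal.ofReal (Y * ρ ^ n)) :
    ∫⁻ y in closedBall x ρ ∩ Ω, ENNReal.ofReal (φ y)
      ≤ ENNReal.ofReal
        ((unitBallVolume n + K ^ L * Real.exp (n * L)) * ρ ^ n * Y ^ (1 / p x)) := by
  have hm : MeasurableSet (closedBall x ρ ∩ Ω) := measurableSet_closedBall.inter hΩ
  have hV := unitBallVolume_nonneg n
  have hpx := hp x hx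
  have hpx0 : 0 < p x := by linarith
  have hφ0 : ∀ y, 0 ≤ φ y := fun y => by rcases hφ y with h | h <;> linarith
  set C := K ^ L * Real.exp (n * L) with hC
  have hC1 : 1 ≤ C := by
    have h1 : 1 ≤ K ^ L := Real.one_le_rpow hK hL.1.le
    have h2 : 1 ≤ Real.exp (n * L) := Real.one_le_exp (mul_nonneg n.cast_nonneg hL.1.le)
    nlinarith
  rcases le_total Y 1 with hY1 | hY1
  · have h1 : ∫⁻ y in closedBall x ρ ∩ Ω, ENNReal.ofReal (φ y)
        ≤ ∫⁻ y in closedBall x ρ ∩ Ω, ENNReal.ofReal (φ y ^ p y) := by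
      refine setLIntegral_mono' hm fun y hy => ENNReal.ofReal_le_ofReal ?_
      rcases hφ y with h0 | h0
      · rw [h0, Real.zero_rpow (by linarith [hp y hy.2])]
      · simpa using Real.rpow_le_rpow_of_exponent_le h0 (hp y hy.2)
    refine h1.trans (h.trans (ENNReal.ofReal_le_ofReal ?_))
    have h2 : Y ≤ Y ^ (1 / p x) := by
      simpa using Real.rpow_le_rpow_of_exponent_ge hY hY1 ((div_le_one hpx0).2 hpx)
    calc Y * ρ ^ n ≤ Y ^ (1 / p x) * ρ ^ n := by gcongr
      _ = 1 * (ρ ^ n * Y ^ (1 / p x)) := by ring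
      _ ≤ (unitBallVolume n + C) * (ρ ^ n * Y ^ (1 / p x)) := by gcongr; linarith
      _ = _ := by ring
  · set l := Y ^ (1 / p x) with hl
    have hl1 : 1 ≤ l := Real.one_le_rpow hY1 (by positivity)
    have hl0 : 0 < l := by linarith
    have hlY : l ≤ Y := by
      simpa [hl] using Real.rpow_le_rpow_of_exponent_le hY1 ((div_le_one hpx0).2 hpx)
    have hlp : l ^ p x = Y := by
      rw [hl, ← Real.rpow_mul hY.le, one_div_mul_cancel hpx0.ne', Real.rpow_one]
    -- Where `φ y > l`, write `φ = φ ^ p(y) * φ ^ (1 - p(y))` and bound the last factor by `l ^ (1 -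
    -- p(y))`. Replacing `p(y)` by `p(x)` costs `C`, since `l` is at most a power of the radius.
    have hpt : ∀ y ∈ closedBall x ρ ∩ Ω, ENNReal.ofReal (φ y)
        ≤ ENNReal.ofReal l
          + ENNReal.ofReal (C * l ^ (1 - p x)) * ENNReal.ofReal (φ y ^ p y) := by
      intro y hy
      rw [← ENNReal.ofReal_mul (by positivity), ← ENNReal.ofReal_add hl0.le
        (mul_nonneg (by positivity) (Real.rpow_nonneg (hφ0 y) _))]
      refine ENNReal.ofReal_le_ofReal ?_
      have hpos : 0 ≤ φ y ^ p y := Real.rpow_nonneg (hφ0 y) _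
      rcases le_total (φ y) l with hle | hle
      · have : 0 ≤ C * l ^ (1 - p x) * φ y ^ p y := by positivity
        linarith
      · have hφy : 0 < φ y := by linarith
        have hδ : l ^ (p x - p y) ≤ C :=
          rpow_le_of_abs_le_div_log hl1 hK hρ n.cast_nonneg hL.1.le (hlY.trans hYK)
            (hL.abs_sub_le hx hy.2 hρ (by rw [dist_comm]; exact hy.1))
        calc φ y = φ y ^ p y * φ y ^ (1 - p y) := by
              rw [← Real.rpow_add hφy, add_sub_cancel, Real.rpow_one]
          _ ≤ φ y ^ p y * l ^ (1 - p y) := by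
              gcongr ?_ * ?_
              exact Real.rpow_le_rpow_of_nonpos hl0 hle (by linarith [hp y hy.2])
          _ = l ^ (p x - p y) * l ^ (1 - p x) * φ y ^ p y := by
              rw [← Real.rpow_add hl0]; ring_nf
          _ ≤ C * l ^ (1 - p x) * φ y ^ p y := by gcongr
          _ ≤ _ := by linarith
    refine (setLIntegral_mono' hm hpt).trans ?_
    rw [lintegral_add_left measurable_const, lintegral_const_mul' _ _ ENNReal.ofReal_ne_top,
      setLIntegral_const]
    have hvol : volume (closedBall x ρ ∩ Ω) ≤ ENNReal.ofReal (unitBallVolume n * ρ ^ n) :=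
      (measure_mono inter_subset_left).trans_eq (volume_closedBall_eq x hρ)
    calc _ ≤ ENNReal.ofReal l * ENNReal.ofReal (unitBallVolume n * ρ ^ n)
          + ENNReal.ofReal (C * l ^ (1 - p x)) * ENNReal.ofReal (Y * ρ ^ n) := by gcongr
      _ = ENNReal.ofReal (l * (unitBallVolume n * ρ ^ n) + C * l ^ (1 - p x) * (Y * ρ ^ n)) := by
          rw [← ENNReal.ofReal_mul hl0.le, ← ENNReal.ofReal_mul (by positivity),
            ← ENNReal.ofReal_add (by positivity) (by positivity)]
      _ = _ := by
          congr 1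
          have : l ^ (1 - p x) * Y = l := by
            rw [← hlp, ← Real.rpow_add hl0, sub_add_cancel, Real.rpow_one]
          linear_combination (C * ρ ^ n) * this

/-! ### Bounds and regularity of the Sobolev exponent. -/

namespace ExponentBounds

variable {n : ℕ} {Ω : Set (EuclideanSpace ℝ (Fin n))} {p α : EuclideanSpace ℝ (Fin n) → ℝ}
  {a b P Lp Lα : ℝ} (H : ExponentBounds Ω p α a b P Lp Lα)

include H

theorem n_pos : (0 : ℝ) < n := by
  have := H.two_le
  positivity

theorem sub_pos {x : EuclideanSpace ℝ (Fin n)} (hx : x ∈ Ω) : 0 < (n : ℝ) - α x * p x := by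
  linarith [H.mul_le x hx, H.b_lt]

theorem α_pos {x : EuclideanSpace ℝ (Fin n)} (hx : x ∈ Ω) : 0 < α x :=
  H.a_pos.trans_le (H.a_le x hx)

theorem α_le {x : EuclideanSpace ℝ (Fin n)} (hx : x ∈ Ω) : α x ≤ b := by
  nlinarith [H.mul_le x hx, H.one_le x hx, H.α_pos hx]

theorem one_le_sharpExponent {x : EuclideanSpace ℝ (Fin n)} (hx : x ∈ Ω) :
    1 ≤ sharpExponent α p x := by
  rw [sharpExponent, le_div_iff₀ (H.sub_pos hx)]
  nlinarith [H.one_le x hx, H.α_pos hx, H.n_pos]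

theorem sharpExponent_le {x : EuclideanSpace ℝ (Fin n)} (hx : x ∈ Ω) :
    sharpExponent α p x ≤ n * P / (n - b) := by
  have := H.b_lt
  have := H.one_le x hx
  have := H.le_P x hx
  have := H.mul_le x hx
  rw [sharpExponent]
  have : 0 < (n : ℝ) - b := by linarith
  have : 0 ≤ P := by linarith
  gcongr

/-- Over a common denominator the mixed terms combine into `p x * p y * (α x - α y)`, and the
denominators stay above `n - b`. Thus `p#` inherits the log-Hölder modulus. -/
theorem abs_sharpExponent_sub_le {x y : EuclideanSpace ℝ (Fin n)} (hx : x ∈ Ω) (hy : y ∈ Ω)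
    {ρ : ℝ} (hρ : 0 < ρ) (hd : dist x y ≤ ρ) :
    |sharpExponent α p x - sharpExponent α p y|
      ≤ n * (n * Lp + P ^ 2 * Lα) / (n - b) ^ 2 / Real.log (Real.exp 1 + 1 / ρ) := by
  have h1 := H.logHolder_p.abs_sub_le hx hy hρ hd
  have h2 := H.logHolder_α.abs_sub_le hx hy hρ hd
  set w := Real.log (Real.exp 1 + 1 / ρ)
  have hx0 := H.sub_pos hx
  have hy0 := H.sub_pos hy
  have hb : 0 < (n : ℝ) - b := by linarith [H.b_lt]
  have hn := H.n_pos
  have hpx := H.one_le x hx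
  have hpy := H.one_le y hy
  have hPx := H.le_P x hx
  have hPy := H.le_P y hy
  have hP : 0 ≤ P := by linarith
  have hbx : (n : ℝ) - b ≤ n - α x * p x := by linarith [H.mul_le x hx]
  have hby : (n : ℝ) - b ≤ n - α y * p y := by linarith [H.mul_le y hy]
  have e : sharpExponent α p x - sharpExponent α p y
      = n * (n * (p x - p y) + p x * p y * (α x - α y))
        / ((n - α x * p x) * (n - α y * p y)) := by
    rw [sharpExponent, sharpExponent, div_sub_div _ _ hx0.ne' hy0.ne']
    congr 1; ring
  have hnum : |(n : ℝ) * (p x - p y) + p x * p y * (α x - α y)|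
      ≤ n * (Lp / w) + P ^ 2 * (Lα / w) := by
    refine (abs_add_le _ _).trans ?_
    rw [abs_mul, abs_mul, abs_of_pos hn, abs_of_pos (by positivity : 0 < p x * p y)]
    have : p x * p y ≤ P ^ 2 := by rw [pow_two]; gcongr
    gcongr
  have hden : ((n : ℝ) - b) ^ 2 ≤ (n - α x * p x) * (n - α y * p y) := by
    rw [pow_two]; gcongr
  rw [e, abs_div, abs_mul, abs_of_pos hn, abs_of_pos (mul_pos hx0 hy0)]
  have h0 : 0 ≤ (n : ℝ) * (Lp / w) + P ^ 2 * (Lα / w) := (abs_nonneg _).trans hnum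
  calc _ ≤ n * (n * (Lp / w) + P ^ 2 * (Lα / w)) / ((n : ℝ) - b) ^ 2 := by gcongr
    _ = _ := by ring

end ExponentBounds

/-! ### Hedberg's estimate. -/

/-- The constant in the Hedberg type estimate. -/
noncomputable def hedbergConst (n : ℕ) (a b P L K : ℝ) : ℝ :=
  n * (unitBallVolume n + K ^ L * Real.exp (n * L)) * (1 / a + K * P / (n - b))

theorem measure_singleton_of_absolutelyContinuous {n : ℕ} (hn : 2 ≤ n)
    {μ : Measure (EuclideanSpace ℝ (Fin n))} (hμ : μ ≪ volume)
    (x : EuclideanSpace ℝ (Fin n)) : μ {x} = 0 := by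
  have : NeZero n := ⟨by omega⟩
  have : Nontrivial (EuclideanSpace ℝ (Fin n)) := inferInstance
  exact hμ (measure_singleton x)

/-- Hedberg type estimate: if the averages of `φ ^ p` over balls centred at `x` are at most
`s ^ (p#(x))`, then the Riesz potential of `φ` at `x` is at most a multiple of `s`. -/
theorem ExponentBounds.rieszPotential_le {n : ℕ} {Ω : Set (EuclideanSpace ℝ (Fin n))}
    {p α : EuclideanSpace ℝ (Fin n) → ℝ} {a b P Lp Lα : ℝ}
    (H : ExponentBounds Ω p α a b P Lp Lα) {φ : EuclideanSpace ℝ (Fin n) → ℝ} {K s : ℝ}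
    (hφ : ∀ y, φ y = 0 ∨ 1 ≤ φ y) (hφm : AEMeasurable φ (volume.restrict Ω)) (hK : 1 ≤ K)
    (hmod : ∫⁻ y in Ω, ENNReal.ofReal (φ y ^ p y) ≤ ENNReal.ofReal K) (hs : 0 < s)
    {x : EuclideanSpace ℝ (Fin n)} (hx : x ∈ Ω)
    (h : ∀ ρ, 0 < ρ → ∫⁻ y in closedBall x ρ ∩ Ω, ENNReal.ofReal (φ y ^ p y)
      ≤ ENNReal.ofReal (s ^ sharpExponent α p x * ρ ^ n)) :
    rieszPotential Ω α φ x ≤ ENNReal.ofReal (hedbergConst n a b P Lp K * s) := by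
  have hn := H.n_pos
  have hsub := H.sub_pos hx
  have hα := H.α_pos hx
  have hpx := H.one_le x hx
  have hpx0 : 0 < p x := by linarith
  have hPx := H.le_P x hx
  have hb : 0 < (n : ℝ) - b := by linarith [H.b_lt]
  have hαn : α x < n := by linarith [H.α_le hx, H.b_lt]
  have ha := H.a_pos
  have hK0 : 0 < K := by linarith
  have hV := unitBallVolume_nonneg n
  have hφ0 : ∀ y, 0 ≤ φ y := fun y => by rcases hφ y with h | h <;> linarith
  set B := unitBallVolume n + K ^ Lp * Real.exp (n * Lp) with hB
  have hB0 : 0 ≤ B := by positivity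
  set v := (n : ℝ) / p x - α x with hv
  have hv' : v = (n - α x * p x) / p x := by rw [hv]; field_simp
  have hv0 : 0 < v := by rw [hv']; positivity
  set q := sharpExponent α p x with hq
  -- The radius that balances the two ranges: `r ^ (-n) = s ^ q`, and both the inner and the outer
  -- contribution become multiples of `s`.
  set r := s ^ (-(q / n)) with hr
  have hr0 : 0 < r := Real.rpow_pos_of_pos hs _
  have hrn : r ^ (-(n : ℝ)) = s ^ q := by
    rw [hr, ← Real.rpow_mul hs.le]; congr 1; field_simp
  have hrv : r ^ (-v) = s := by
    rw [hr, ← Real.rpow_mul hs.le]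
    have : -(q / n) * -v = 1 := by
      rw [hq, sharpExponent, hv', neg_mul_neg, div_mul_div_comm, div_mul_cancel₀ _ hsub.ne',
        mul_comm, div_self (by positivity)]
    rw [this, Real.rpow_one]
  have hball : ∀ ρ, (volume.restrict Ω).withDensity (fun y => ‖φ y‖ₑ) (ball x ρ)
      ≤ ∫⁻ y in closedBall x ρ ∩ Ω, ENNReal.ofReal (φ y) := by
    intro ρ
    refine (measure_mono ball_subset_closedBall).trans_eq ?_
    rw [withDensity_apply _ measurableSet_closedBall,
      Measure.restrict_restrict measurableSet_closedBall]
    exact lintegral_congr fun y => Real.enorm_eq_ofReal (hφ0 y)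
  rw [rieszPotential_eq_lintegral_withDensity hφm]
  refine (lintegral_edist_rpow_neg_le _ (measure_singleton_of_absolutelyContinuous H.two_le
    ((withDensity_absolutelyContinuous _ _).trans Measure.absolutelyContinuous_restrict) _)
    (u := α x) (v := v) (A := B * r ^ (-(n / p x))) (A' := B * K ^ (1 / p x)) (r := r)
    (by linarith) hα hv0 (by positivity) (by positivity) hr0 ?_ ?_).trans ?_
  · intro ρ hρ hρr
    refine (hball ρ).trans ((setLIntegral_le_of_setLIntegral_rpow_le H.measurableSet H.one_le
      H.logHolder_p hφ hK hρ (Y := s ^ q) (by positivity) ?_ hx (h ρ hρ)).trans_eq ?_)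
    · rw [← hrn]
      calc r ^ (-(n : ℝ)) ≤ ρ ^ (-(n : ℝ)) :=
            Real.rpow_le_rpow_of_nonpos hρ hρr (by linarith)
        _ ≤ _ := le_mul_of_one_le_left (by positivity) hK
    · rw [sub_add_cancel, Real.rpow_natCast, ← hrn, ← Real.rpow_mul hr0.le]
      congr 1
      rw [show -(n : ℝ) * (1 / p x) = -(n / p x) by ring]; ring
  · intro ρ hρr
    have hρ : 0 < ρ := hr0.trans hρr
    have hc : ρ ^ (-(n : ℝ)) * ρ ^ n = 1 := by
      rw [Real.rpow_neg hρ.le, Real.rpow_natCast]; field_simp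
    -- Beyond `r` only the total modular is used, so `Y` is the largest value that the Jensen
    -- inequality admits.
    refine (hball ρ).trans ((setLIntegral_le_of_setLIntegral_rpow_le H.measurableSet H.one_le
      H.logHolder_p hφ hK hρ (Y := K * ρ ^ (-(n : ℝ))) (by positivity) le_rfl hx ?_).trans_eq ?_)
    · rw [mul_assoc, hc, mul_one]
      exact (lintegral_mono_set inter_subset_right).trans hmod
    · congr 1
      rw [Real.mul_rpow hK0.le (by positivity), ← Real.rpow_mul hρ.le,
        show (n : ℝ) - α x - v = n + -n * (1 / p x) by rw [hv]; ring,
        Real.rpow_add hρ, Real.rpow_natCast]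
      ring
  · refine ENNReal.ofReal_le_ofReal ?_
    have e1 : r ^ (-(n / p x)) * r ^ α x = s := by
      rw [← Real.rpow_add hr0, ← hrv, hv]; ring_nf
    have i1 : 1 / α x ≤ 1 / a := one_div_le_one_div_of_le ha (H.a_le x hx)
    have i2 : 1 / v ≤ P / (n - b) := by
      rw [hv', one_div_div]
      have := H.mul_le x hx
      have : 0 ≤ P := by linarith
      gcongr
    have i3 : K ^ (1 / p x) ≤ K := by
      simpa using Real.rpow_le_rpow_of_exponent_le hK ((div_le_one hpx0).2 hpx)
    calc _ = (n - α x) * B * (r ^ (-(n / p x)) * r ^ α x * (1 / α x)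
            + K ^ (1 / p x) * (r ^ (-v) * (1 / v))) := by ring
      _ = (n - α x) * B * (1 / α x + K ^ (1 / p x) * (1 / v)) * s := by rw [e1, hrv]; ring
      _ ≤ n * B * (1 / a + K * (P / (n - b))) * s := by
          gcongr
          linarith
      _ = _ := by rw [hedbergConst]; ring

/-! ### Large levels: the covering argument. -/

/-- The constant in the weak type estimate for functions without small values. -/
noncomputable def weakConst (n : ℕ) (b P Lp Lα K : ℝ) : ℝ :=
  (K * 5 ^ n) ^ (n * (n * Lp + P ^ 2 * Lα) / (n - b) ^ 2)
    * Real.exp (n * (n * (n * Lp + P ^ 2 * Lα) / (n - b) ^ 2)) * (unitBallVolume n * 5 ^ n)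

/-- The constant in the estimate of the integral of the Riesz kernel over a set of
diameter `d`. -/
noncomputable def kernelConst (n : ℕ) (a d : ℝ) : ℝ :=
  max 1 d ^ (n : ℝ) * ((n - a) * (unitBallVolume n * (max 1 d ^ a / a)
    + unitBallVolume n * max 1 d ^ n * (max 1 d ^ (-(n - a)) / (n - a))))

namespace ExponentBounds

variable {n : ℕ} {Ω : Set (EuclideanSpace ℝ (Fin n))} {p α : EuclideanSpace ℝ (Fin n) → ℝ}
  {a b P Lp Lα : ℝ} (H : ExponentBounds Ω p α a b P Lp Lα)

include H

theorem setLIntegral_rpow_sharpExponent_le {φ : EuclideanSpace ℝ (Fin n) → ℝ} {K s : ℝ}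
    (hφ : ∀ y, φ y = 0 ∨ 1 ≤ φ y) (hφm : AEMeasurable φ (volume.restrict Ω)) (hK : 1 ≤ K)
    (hmod : ∫⁻ y in Ω, ENNReal.ofReal (φ y ^ p y) ≤ ENNReal.ofReal K) (hs : 1 ≤ s) :
    ∫⁻ x in {x | x ∈ Ω ∧
        ENNReal.ofReal (hedbergConst n a b P Lp K * s) < rieszPotential Ω α φ x},
      ENNReal.ofReal (s ^ sharpExponent α p x)
      ≤ ENNReal.ofReal (weakConst n b P Lp Lα K)
        * ∫⁻ y in Ω, ENNReal.ofReal (φ y ^ p y) := by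
  set T := {x | x ∈ Ω ∧
    ENNReal.ofReal (hedbergConst n a b P Lp K * s) < rieszPotential Ω α φ x}
  set L := n * (n * Lp + P ^ 2 * Lα) / (n - b) ^ 2 with hL
  set D := (K * 5 ^ n) ^ L * Real.exp (n * L) with hD
  have hs0 : 0 < s := by linarith
  have hK0 : 0 < K := by linarith
  have hn := H.n_pos
  have hn0 : n ≠ 0 := by have := H.two_le; omega
  have hL0 : 0 ≤ L := by
    have := H.logHolder_p.1
    have := H.logHolder_α.1
    positivity
  have hV := unitBallVolume_nonneg n
  -- Contrapositive of Hedberg's estimate.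
  have hex : ∀ x ∈ T, ∃ ρ, 0 < ρ ∧ ENNReal.ofReal (s ^ sharpExponent α p x * ρ ^ n)
      < ∫⁻ y in closedBall x ρ ∩ Ω, ENNReal.ofReal (φ y ^ p y) := by
    intro x hx
    by_contra! hcon
    exact absurd (H.rieszPotential_le hφ hφm hK hmod hs0 hx.1 hcon) (not_le.2 hx.2)
  choose! R hR0 hR using hex
  have hRK : ∀ x ∈ T, s ^ sharpExponent α p x * R x ^ n ≤ K := by
    intro x hx
    have := (hR x hx).le.trans ((lintegral_mono_set inter_subset_right).trans hmod)
    rwa [ENNReal.ofReal_le_ofReal_iff hK0.le] at this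
  have hsq : ∀ x ∈ T, s ≤ s ^ sharpExponent α p x := fun x hx => by
    simpa using Real.rpow_le_rpow_of_exponent_le hs (H.one_le_sharpExponent hx.1)
  -- Vitali's lemma needs bounded radii; here `s ≥ 1` turns the modular bound into one.
  have hRle : ∀ x ∈ T, R x ≤ K := by
    intro x hx
    rcases le_total (R x) 1 with h1 | h1
    · exact h1.trans hK
    · have h2 : R x ≤ R x ^ n := le_self_pow₀ h1 hn0
      have h3 : 1 ≤ s ^ sharpExponent α p x := hs.trans (hsq x hx)
      nlinarith [hRK x hx]
  obtain ⟨u, huT, hdisj, hcov⟩ := Vitali.exists_disjoint_subfamily_covering_enlargement_closedBall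
    T (fun x => x) R K hRle 5 (by norm_num)
  have hcount : u.Countable := hdisj.countable_of_nonempty_interior fun x hx =>
    ⟨x, interior_mono ball_subset_closedBall (by
      rw [isOpen_ball.interior_eq]; exact mem_ball_self (hR0 x (huT hx)))⟩
  have hsub : T ⊆ ⋃ x ∈ u, closedBall x (5 * R x) ∩ Ω := by
    intro y hy
    obtain ⟨x, hxu, hx⟩ := hcov y hy
    exact mem_biUnion hxu ⟨hx (mem_closedBall_self (hR0 y hy).le), hy.1⟩
  have hone : ∀ x ∈ u, ∫⁻ y in closedBall x (5 * R x) ∩ Ω, ENNReal.ofReal (s ^ sharpExponent α p y)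
      ≤ ENNReal.ofReal (weakConst n b P Lp Lα K)
        * ∫⁻ y in closedBall x (R x) ∩ Ω, ENNReal.ofReal (φ y ^ p y) := by
    intro x hxu
    have hx := huT hxu
    have hr := hR0 x hx
    have hpt : ∀ y ∈ closedBall x (5 * R x) ∩ Ω, ENNReal.ofReal (s ^ sharpExponent α p y)
        ≤ ENNReal.ofReal (D * s ^ sharpExponent α p x) := by
      intro y hy
      refine ENNReal.ofReal_le_ofReal ?_
      -- Since `s ≤ s ^ p#(x) ≤ K * R x ^ (-n)`, the oscillation of `p#` on the enlarged ball is
      -- harmless; the factor `5 ^ n` in `D` comes from rewriting this with the radius `5 * R x`.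
      have hδ : s ^ (sharpExponent α p y - sharpExponent α p x) ≤ D := by
        refine rpow_le_of_abs_le_div_log hs ?_ (by positivity : 0 < 5 * R x) hn.le hL0 ?_
          (H.abs_sharpExponent_sub_le hy.2 hx.1 (by positivity) hy.1)
        · exact one_le_mul_of_one_le_of_one_le hK (one_le_pow₀ (by norm_num))
        · rw [Real.rpow_neg (by positivity), Real.rpow_natCast, mul_pow, ← div_eq_mul_inv,
            mul_comm K, mul_div_mul_left _ _ (by positivity), le_div_iff₀ (by positivity)]
          exact (mul_le_mul_of_nonneg_right (hsq x hx) (by positivity)).trans (hRK x hx)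
      calc s ^ sharpExponent α p y
          = s ^ (sharpExponent α p y - sharpExponent α p x) * s ^ sharpExponent α p x := by
            rw [← Real.rpow_add hs0, sub_add_cancel]
        _ ≤ _ := by gcongr
    refine (setLIntegral_mono' (measurableSet_closedBall.inter H.measurableSet) hpt).trans ?_
    rw [setLIntegral_const]
    calc _ ≤ ENNReal.ofReal (D * s ^ sharpExponent α p x)
          * ENNReal.ofReal (unitBallVolume n * (5 * R x) ^ n) := by
          gcongr
          exact (measure_mono inter_subset_left).trans_eq
            (volume_closedBall_eq x (by positivity))
      _ = ENNReal.ofReal (weakConst n b P Lp Lα K)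
          * ENNReal.ofReal (s ^ sharpExponent α p x * R x ^ n) := by
          rw [← ENNReal.ofReal_mul (by positivity), weakConst, ← hL, ← hD,
            ← ENNReal.ofReal_mul (by positivity)]
          congr 1
          rw [mul_pow]; ring
      _ ≤ _ := by gcongr; exact (hR x hx).le
  have : Countable u := hcount.to_subtype
  calc _ ≤ ∫⁻ y in ⋃ x ∈ u, closedBall x (5 * R x) ∩ Ω,
        ENNReal.ofReal (s ^ sharpExponent α p y) := lintegral_mono_set hsub
    _ ≤ ∑' x : u, ∫⁻ y in closedBall (x : EuclideanSpace ℝ (Fin n)) (5 * R x) ∩ Ω,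
        ENNReal.ofReal (s ^ sharpExponent α p y) := by
        rw [biUnion_eq_iUnion]; exact lintegral_iUnion_le _ _
    _ ≤ ∑' x : u, ENNReal.ofReal (weakConst n b P Lp Lα K)
        * ∫⁻ y in closedBall (x : EuclideanSpace ℝ (Fin n)) (R x) ∩ Ω,
          ENNReal.ofReal (φ y ^ p y) := ENNReal.tsum_le_tsum fun x => hone x x.2
    _ = ENNReal.ofReal (weakConst n b P Lp Lα K)
        * ∫⁻ y in ⋃ x ∈ u, closedBall x (R x) ∩ Ω, ENNReal.ofReal (φ y ^ p y) := by
        rw [ENNReal.tsum_mul_left, lintegral_biUnion hcount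
          (fun x _ => measurableSet_closedBall.inter H.measurableSet)
          (hdisj.mono fun x => inter_subset_left)]
    _ ≤ _ := by
        gcongr
        exact iUnion₂_subset fun x _ => inter_subset_right

/-! ### Comparison with a kernel of constant order, and small levels. -/

theorem a_lt {x : EuclideanSpace ℝ (Fin n)} (hx : x ∈ Ω) : a < n :=
  ((H.a_le x hx).trans (H.α_le hx)).trans_lt H.b_lt

/-- Boundedness of `Ω` allows replacing the order `α x` by its lower bound `a`, which makes the
kernel symmetric and ready for Tonelli's theorem. -/
theorem edist_rpow_le (hb : Bornology.IsBounded Ω) {x y : EuclideanSpace ℝ (Fin n)}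
    (hx : x ∈ Ω) (hy : y ∈ Ω) :
    edist x y ^ (-((n : ℝ) - α x))
      ≤ ENNReal.ofReal (max 1 (diam Ω) ^ (n : ℝ)) * edist x y ^ (-((n : ℝ) - a)) := by
  have han := H.a_lt hx
  rcases eq_or_ne x y with rfl | hne
  · rw [edist_self, ENNReal.zero_rpow_of_neg (y := -((n : ℝ) - a)) (by linarith),
      ENNReal.mul_top (by positivity)]
    exact le_top
  · have hd : 0 < dist x y := dist_pos.2 hne
    have hdm : dist x y ≤ max 1 (diam Ω) := (dist_le_diam_of_mem hb hx hy).trans (le_max_right _ _)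
    rw [edist_dist, ENNReal.ofReal_rpow_of_pos hd, ENNReal.ofReal_rpow_of_pos hd,
      ← ENNReal.ofReal_mul (by positivity)]
    refine ENNReal.ofReal_le_ofReal ?_
    have h0 : 0 ≤ α x - a := by linarith [H.a_le x hx]
    calc dist x y ^ (-((n : ℝ) - α x))
        = dist x y ^ (α x - a) * dist x y ^ (-((n : ℝ) - a)) := by
          rw [← Real.rpow_add hd]; ring_nf
      _ ≤ max 1 (diam Ω) ^ (α x - a) * dist x y ^ (-((n : ℝ) - a)) := by gcongr
      _ ≤ _ := by
          gcongr
          · exact le_max_left _ _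
          · linarith [H.α_le hx, H.b_lt, H.a_pos]

theorem setLIntegral_kernel_le (hb : Bornology.IsBounded Ω) {x : EuclideanSpace ℝ (Fin n)}
    (hx : x ∈ Ω) :
    ∫⁻ y in Ω, ENNReal.ofReal (max 1 (diam Ω) ^ (n : ℝ)) * edist x y ^ (-((n : ℝ) - a))
      ≤ ENNReal.ofReal (kernelConst n a (diam Ω)) := by
  have han := H.a_lt hx
  have ha := H.a_pos
  have hV := unitBallVolume_nonneg n
  have hd : 0 < max 1 (diam Ω) := by positivity
  rw [lintegral_const_mul' _ _ ENNReal.ofReal_ne_top, kernelConst,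
    ENNReal.ofReal_mul (by positivity)]
  gcongr
  -- The choice `v = n - a` makes the outer growth exponent zero: past radius `max 1 (diam Ω)` the
  -- mass of balls no longer grows.
  refine lintegral_edist_rpow_neg_le _ (measure_singleton_of_absolutelyContinuous H.two_le
    Measure.absolutelyContinuous_restrict _) (by linarith) ha (by linarith) hV
    (by positivity) hd ?_ ?_
  · intro ρ hρ _
    rw [sub_add_cancel, Real.rpow_natCast, ← volume_closedBall_eq x hρ]
    exact (Measure.restrict_apply_le _ _).trans (measure_mono ball_subset_closedBall)
  · intro ρ _
    rw [sub_self, Real.rpow_zero, mul_one, ← volume_closedBall_eq x hd]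
    refine (measure_mono (subset_univ _)).trans ?_
    rw [Measure.restrict_apply_univ]
    refine measure_mono fun y hy => ?_
    exact (dist_le_diam_of_mem hb hy hx).trans (le_max_right _ _)

theorem rieszPotential_le_add (hb : Bornology.IsBounded Ω) {f g : EuclideanSpace ℝ (Fin n) → ℝ}
    (hfg : ∀ y, ‖f y‖ₑ ≤ ‖g y‖ₑ + 1) {x : EuclideanSpace ℝ (Fin n)} (hx : x ∈ Ω) :
    rieszPotential Ω α f x
      ≤ rieszPotential Ω α g x + ENNReal.ofReal (kernelConst n a (diam Ω)) := by
  have hm : Measurable fun y => 1 / edist x y ^ ((n : ℝ) - α x) := by fun_prop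
  calc rieszPotential Ω α f x
      ≤ ∫⁻ y in Ω, (‖g y‖ₑ / edist x y ^ ((n : ℝ) - α x)
          + 1 / edist x y ^ ((n : ℝ) - α x)) := by
        refine lintegral_mono fun y => ?_
        rw [← ENNReal.add_div]
        gcongr
        exact hfg y
    _ = rieszPotential Ω α g x + ∫⁻ y in Ω, 1 / edist x y ^ ((n : ℝ) - α x) := by
        rw [lintegral_add_right _ hm, rieszPotential]
    _ ≤ _ := by
        gcongr
        refine le_trans (setLIntegral_mono' H.measurableSet fun y hy => ?_)
          (H.setLIntegral_kernel_le hb hx)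
        rw [one_div, ← ENNReal.rpow_neg]
        exact H.edist_rpow_le hb hx hy

theorem setLIntegral_rpow_sharpExponent_le_of_le (hb : Bornology.IsBounded Ω)
    {f : EuclideanSpace ℝ (Fin n) → ℝ} (hf : AEMeasurable f (volume.restrict Ω)) {t T : ℝ}
    (ht : 0 < t) (hT : 1 ≤ T) (htT : t ≤ T) :
    ∫⁻ x in {x | x ∈ Ω ∧ ENNReal.ofReal t < rieszPotential Ω α f x},
        ENNReal.ofReal (t ^ sharpExponent α p x)
      ≤ ENNReal.ofReal (T ^ (n * P / (n - b)) * kernelConst n a (diam Ω))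
        * ∫⁻ y in Ω, ‖f y‖ₑ := by
  set Q := n * P / (n - b)
  set ν := (volume.restrict Ω).withDensity fun y => ‖f y‖ₑ with hν
  set k : EuclideanSpace ℝ (Fin n) → EuclideanSpace ℝ (Fin n) → ℝ≥0∞ := fun x y =>
    ENNReal.ofReal (max 1 (diam Ω) ^ (n : ℝ)) * edist x y ^ (-((n : ℝ) - a)) with hk
  have hkm : Measurable (Function.uncurry k) := by
    simp only [hk, Function.uncurry_def]; fun_prop
  have hGm : Measurable fun x => ∫⁻ y, k x y ∂ν := hkm.lintegral_prod_right
  have hνΩ : ∀ᵐ y ∂ν, y ∈ Ω :=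
    (withDensity_absolutelyContinuous _ _).ae_le (ae_restrict_mem H.measurableSet)
  have hsub : {x | x ∈ Ω ∧ ENNReal.ofReal t < rieszPotential Ω α f x}
      ⊆ {x | ENNReal.ofReal t ≤ ∫⁻ y, k x y ∂ν} ∩ Ω := by
    rintro x ⟨hx, hlt⟩
    refine ⟨hlt.le.trans ?_, hx⟩
    rw [rieszPotential_eq_lintegral_withDensity hf]
    refine lintegral_mono_ae ?_
    filter_upwards [hνΩ] with y hy using H.edist_rpow_le hb hx hy
  have hset : MeasurableSet {x | ENNReal.ofReal t ≤ ∫⁻ y, k x y ∂ν} :=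
    measurableSet_le measurable_const hGm
  have hpt : ∀ x ∈ {x | ENNReal.ofReal t ≤ ∫⁻ y, k x y ∂ν} ∩ Ω,
      ENNReal.ofReal (t ^ sharpExponent α p x) ≤ ENNReal.ofReal (T ^ Q) * ENNReal.ofReal t := by
    rintro x ⟨-, hx⟩
    rw [← ENNReal.ofReal_mul (by positivity)]
    refine ENNReal.ofReal_le_ofReal ?_
    have h1 := H.one_le_sharpExponent hx
    calc t ^ sharpExponent α p x = t ^ (sharpExponent α p x - 1) * t := by
          rw [← Real.rpow_add_one ht.ne', sub_add_cancel]
      _ ≤ T ^ (sharpExponent α p x - 1) * t := by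
          gcongr
      _ ≤ T ^ Q * t := by
          gcongr
          linarith [H.sharpExponent_le hx]
  -- One factor `t` is kept for Chebyshev's inequality; exchanging the integrals then leaves the
  -- kernel integral in `x`, bounded uniformly in `y`.
  calc _ ≤ ∫⁻ x in {x | ENNReal.ofReal t ≤ ∫⁻ y, k x y ∂ν} ∩ Ω,
        ENNReal.ofReal (t ^ sharpExponent α p x) := lintegral_mono_set hsub
    _ ≤ ENNReal.ofReal (T ^ Q) * ENNReal.ofReal t
        * (volume.restrict Ω) {x | ENNReal.ofReal t ≤ ∫⁻ y, k x y ∂ν} := by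
        rw [Measure.restrict_apply hset, ← setLIntegral_const]
        exact setLIntegral_mono' (hset.inter H.measurableSet) hpt
    _ ≤ ENNReal.ofReal (T ^ Q) * ∫⁻ x in Ω, ∫⁻ y, k x y ∂ν := by
        rw [mul_assoc]
        gcongr
        exact mul_meas_ge_le_lintegral hGm _
    _ = ENNReal.ofReal (T ^ Q) * ∫⁻ y, (∫⁻ x in Ω, k x y) ∂ν := by
        rw [lintegral_lintegral_swap hkm.aemeasurable]
    _ ≤ ENNReal.ofReal (T ^ Q) * ∫⁻ _, ENNReal.ofReal (kernelConst n a (diam Ω)) ∂ν := by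
        refine mul_le_mul_right (lintegral_mono_ae ?_) _
        filter_upwards [hνΩ] with y hy
        simp only [hk, edist_comm _ y]
        exact H.setLIntegral_kernel_le hb hy
    _ = _ := by
        rw [lintegral_const, hν, withDensity_apply _ MeasurableSet.univ, Measure.restrict_univ,
          ← mul_assoc, ← ENNReal.ofReal_mul (by positivity)]

end ExponentBounds

/-! ### Modular, norm and essential bounds. -/

theorem setLIntegral_enorm_le_modular_add {n : ℕ} {Ω : Set (EuclideanSpace ℝ (Fin n))}
    (hΩ : MeasurableSet Ω) {p f : EuclideanSpace ℝ (Fin n) → ℝ} (hp : ∀ x ∈ Ω, 1 ≤ p x)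
    (hpm : AEMeasurable p (volume.restrict Ω)) (hfm : AEMeasurable f (volume.restrict Ω)) :
    ∫⁻ y in Ω, ‖f y‖ₑ ≤ modular Ω p f + volume {x | x ∈ Ω ∧ 0 < |f x| ∧ |f x| ≤ 1} := by
  set S := {x | 0 < |f x| ∧ |f x| ≤ 1} with hS
  have hfm' : AEMeasurable (fun y => |f y|) (volume.restrict Ω) := by
    simpa only [Real.norm_eq_abs] using hfm.norm
  calc ∫⁻ y in Ω, ‖f y‖ₑ
      ≤ ∫⁻ y in Ω, (ENNReal.ofReal (|f y| ^ p y) + S.indicator (fun _ => 1) y) := by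
        refine setLIntegral_mono' hΩ fun y hy => ?_
        rw [← ofReal_norm, Real.norm_eq_abs]
        rcases (abs_nonneg (f y)).eq_or_lt with h0 | h0
        · rw [← h0]; simp
        rcases le_or_gt (|f y|) 1 with h1 | h1
        · rw [indicator_of_mem (show y ∈ S from ⟨h0, h1⟩)]
          refine le_add_left ?_
          simpa using h1
        · refine le_add_right (ENNReal.ofReal_le_ofReal ?_)
          simpa using Real.rpow_le_rpow_of_exponent_le h1.le (hp y hy)
    _ = modular Ω p f + ∫⁻ y in Ω, S.indicator (fun _ => 1) y :=
        lintegral_add_left' (hfm'.pow hpm).ennreal_ofReal _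
    _ ≤ modular Ω p f + 1 * (volume.restrict Ω) S := by
        gcongr
        exact lintegral_indicator_const_le _ _
    _ = _ := by
        rw [one_mul, Measure.restrict_apply' hΩ, inter_comm]
        rfl

theorem modular_le_of_luxemburgNorm_le_one {n : ℕ} {Ω : Set (EuclideanSpace ℝ (Fin n))}
    (hΩ : MeasurableSet Ω) {p f : EuclideanSpace ℝ (Fin n) → ℝ} {P : ℝ}
    (hp : ∀ x ∈ Ω, 0 ≤ p x) (hP : ∀ x ∈ Ω, p x ≤ P) (h : luxemburgNorm Ω p f ≤ 1) :
    modular Ω p f ≤ ENNReal.ofReal (2 ^ P) := by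
  -- The slack up to `2` avoids showing that the infimum is attained, at the price of the factor `2
  -- ^ P`.
  have h2 : luxemburgNorm Ω p f < ENNReal.ofReal 2 :=
    h.trans_lt (by norm_num)
  simp only [luxemburgNorm, iInf_lt_iff] at h2
  obtain ⟨l, hl, hm, hl2⟩ := h2
  have hl2 : l < 2 := (ENNReal.ofReal_lt_ofReal_iff (by norm_num)).1 hl2
  calc modular Ω p f
      ≤ ∫⁻ x in Ω, ENNReal.ofReal (2 ^ P) * ENNReal.ofReal (|f x / l| ^ p x) := by
        refine setLIntegral_mono' hΩ fun x hx => ?_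
        rw [← ENNReal.ofReal_mul (by positivity)]
        refine ENNReal.ofReal_le_ofReal ?_
        calc |f x| ^ p x = l ^ p x * |f x / l| ^ p x := by
              rw [← Real.mul_rpow hl.le (abs_nonneg _), abs_div, abs_of_pos hl,
                mul_div_cancel₀ _ hl.ne']
          _ ≤ 2 ^ p x * |f x / l| ^ p x := by
              have := hp x hx
              gcongr
          _ ≤ _ := by
              gcongr
              · norm_num
              · exact hP x hx
    _ = ENNReal.ofReal (2 ^ P) * modular Ω p (fun x => f x / l) :=
        lintegral_const_mul' _ _ ENNReal.ofReal_ne_top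
    _ ≤ _ := mul_le_of_le_one_right' hm

/-- By continuity a violation would persist on a nonempty open set, which has positive measure. -/
theorem le_of_essSup_le {n : ℕ} {Ω : Set (EuclideanSpace ℝ (Fin n))} (hΩ : IsOpen Ω)
    {g : EuclideanSpace ℝ (Fin n) → ℝ} (hg : ContinuousOn g Ω) {M : ℝ}
    (hM : essSupOn Ω g ≤ M) {x : EuclideanSpace ℝ (Fin n)} (hx : x ∈ Ω) : g x ≤ M := by
  by_contra! hlt
  have hopen : IsOpen (Ω ∩ g ⁻¹' Ioi M) := hg.isOpen_inter_preimage hΩ isOpen_Ioi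
  have hpos := hopen.measure_pos volume ⟨x, hx, hlt⟩
  have hae : ∀ᵐ y ∂(volume.restrict Ω), (g y : EReal) ≤ M := by
    filter_upwards [ae_le_essSup (f := fun y => (g y : EReal)) (μ := volume.restrict Ω)]
      with y hy using hy.trans hM
  rw [ae_restrict_iff' hΩ.measurableSet, ae_iff] at hae
  refine hpos.ne' (measure_mono_null ?_ hae)
  rintro y ⟨hy, hy'⟩
  simpa [hy] using hy'

theorem le_of_le_essInf {n : ℕ} {Ω : Set (EuclideanSpace ℝ (Fin n))} (hΩ : IsOpen Ω)
    {g : EuclideanSpace ℝ (Fin n) → ℝ} (hg : ContinuousOn g Ω) {M : ℝ}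
    (hM : M ≤ essInfOn Ω g) {x : EuclideanSpace ℝ (Fin n)} (hx : x ∈ Ω) : M ≤ g x := by
  by_contra! hlt
  have hopen : IsOpen (Ω ∩ g ⁻¹' Iio M) := hg.isOpen_inter_preimage hΩ isOpen_Iio
  have hpos := hopen.measure_pos volume ⟨x, hx, hlt⟩
  have hae : ∀ᵐ y ∂(volume.restrict Ω), (M : EReal) ≤ g y := by
    filter_upwards [ae_essInf_le (f := fun y => (g y : EReal)) (μ := volume.restrict Ω)]
      with y hy using hM.trans hy
  rw [ae_restrict_iff' hΩ.measurableSet, ae_iff] at hae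
  refine hpos.ne' (measure_mono_null ?_ hae)
  rintro y ⟨hy, hy'⟩
  simpa [hy] using hy'

/-! ### Truncation and assembly of the two ranges of levels. -/

/-- The threshold separating small from large levels. -/
noncomputable def levelThreshold (n : ℕ) (a b P Lp d : ℝ) : ℝ :=
  max 1 (max (2 * kernelConst n a d) (2 * max 1 (hedbergConst n a b P Lp (2 ^ P))))

/-- The constant in the weak type inequality for the variable order Riesz potential. -/
noncomputable def rieszWeakTypeConst (n : ℕ) (d a b P Lp Lα : ℝ) : ℝ :=
  max (levelThreshold n a b P Lp d ^ (n * P / (n - b)) * kernelConst n a d)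
    ((2 * max 1 (hedbergConst n a b P Lp (2 ^ P))) ^ (n * P / (n - b))
      * weakConst n b P Lp Lα (2 ^ P))

/-- The truncation of `|f|` that keeps only the values larger than one. -/
noncomputable def largePart {X : Type*} (f : X → ℝ) (y : X) : ℝ :=
  (Ioi (1 : ℝ)).indicator id |f y|

theorem largePart_eq_zero_or_one_le {X : Type*} (f : X → ℝ) (y : X) :
    largePart f y = 0 ∨ 1 ≤ largePart f y := by
  rcases le_or_gt (|f y|) 1 with h | h
  · left; simp [largePart, h]
  · right; simp [largePart, h, h.le]

theorem enorm_le_enorm_largePart_add_one {X : Type*} (f : X → ℝ) (y : X) :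
    ‖f y‖ₑ ≤ ‖largePart f y‖ₑ + 1 := by
  rcases le_or_gt (|f y|) 1 with h | h
  · refine le_add_left ?_
    rw [← ofReal_norm, Real.norm_eq_abs]
    simpa using h
  · refine le_add_right ?_
    simp [largePart, h]

theorem setLIntegral_largePart_rpow_le_modular {n : ℕ} {Ω : Set (EuclideanSpace ℝ (Fin n))}
    (hΩ : MeasurableSet Ω) {p f : EuclideanSpace ℝ (Fin n) → ℝ} (hp : ∀ x ∈ Ω, 1 ≤ p x) :
    ∫⁻ y in Ω, ENNReal.ofReal (largePart f y ^ p y) ≤ modular Ω p f := by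
  refine setLIntegral_mono' hΩ fun y hy => ENNReal.ofReal_le_ofReal ?_
  rcases le_or_gt (|f y|) 1 with h | h
  · have : largePart f y = 0 := by simp [largePart, h]
    rw [this, Real.zero_rpow (by linarith [hp y hy])]
    positivity
  · have : largePart f y = |f y| := by simp [largePart, h]
    rw [this]

theorem ExponentBounds.weak_type {n : ℕ} {Ω : Set (EuclideanSpace ℝ (Fin n))}
    {p α : EuclideanSpace ℝ (Fin n) → ℝ} {a b P Lp Lα : ℝ}
    (H : ExponentBounds Ω p α a b P Lp Lα) (hb : Bornology.IsBounded Ω)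
    {f : EuclideanSpace ℝ (Fin n) → ℝ} (hpm : AEMeasurable p (volume.restrict Ω))
    (hfm : AEMeasurable f (volume.restrict Ω)) (hne : Ω.Nonempty)
    (hmod : modular Ω p f ≤ ENNReal.ofReal (2 ^ P)) {t : ℝ} (ht : 0 < t) :
    ∫⁻ x in {x | x ∈ Ω ∧ ENNReal.ofReal t < rieszPotential Ω α f x},
        ENNReal.ofReal (t ^ sharpExponent α p x)
      ≤ ENNReal.ofReal (rieszWeakTypeConst n (diam Ω) a b P Lp Lα)
        * (modular Ω p f + volume {x | x ∈ Ω ∧ 0 < |f x| ∧ |f x| ≤ 1}) := by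
  set T := levelThreshold n a b P Lp (diam Ω) with hT
  set h₀ := max 1 (hedbergConst n a b P Lp (2 ^ P)) with hh₀
  set Q := n * P / (n - b) with hQ
  rcases le_or_gt t T with htT | htT
  · refine (H.setLIntegral_rpow_sharpExponent_le_of_le hb hfm ht (le_max_left _ _) htT).trans ?_
    gcongr
    · exact le_max_left _ _
    · exact setLIntegral_enorm_le_modular_add H.measurableSet H.one_le hpm hfm
  · have hh1 : 1 ≤ h₀ := le_max_left _ _
    have hh0 : 0 < h₀ := by linarith
    have hP : 0 ≤ P := by
      obtain ⟨x, hx⟩ := hne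
      linarith [H.one_le x hx, H.le_P x hx]
    have hK : (1 : ℝ) ≤ 2 ^ P := Real.one_le_rpow one_le_two hP
    have htk : 2 * kernelConst n a (diam Ω) < t :=
      ((le_max_left _ _).trans (le_max_right _ _)).trans_lt htT
    have hth : 2 * h₀ < t := ((le_max_right _ _).trans (le_max_right _ _)).trans_lt htT
    -- Half of `t` pays for the small values of `f`, the other half dominates Hedberg's constant
    -- times `s`. The threshold ensures `s ≥ 1`.
    set s := t / (2 * h₀) with hs
    have hts : t = 2 * h₀ * s := by rw [hs]; field_simp
    have hs1 : 1 ≤ s := by rw [hs, one_le_div (by positivity)]; exact hth.le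
    have hφm : AEMeasurable (largePart f) (volume.restrict Ω) := by
      have h1 : Measurable ((Ioi (1 : ℝ)).indicator id) := measurable_id.indicator measurableSet_Ioi
      have h2 : AEMeasurable (fun y => |f y|) (volume.restrict Ω) := by
        simpa only [Real.norm_eq_abs] using hfm.norm
      exact h1.comp_aemeasurable h2
    have hφmod := setLIntegral_largePart_rpow_le_modular (f := f) H.measurableSet H.one_le
    set S := {x | x ∈ Ω ∧ ENNReal.ofReal (hedbergConst n a b P Lp (2 ^ P) * s)
      < rieszPotential Ω α (largePart f) x} with hS
    have hsub : {x | x ∈ Ω ∧ ENNReal.ofReal t < rieszPotential Ω α f x} ⊆ S := by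
      rintro x ⟨hx, hlt⟩
      refine ⟨hx, ?_⟩
      by_contra! hle
      refine absurd ?_ (not_le.2 hlt)
      have h1 : hedbergConst n a b P Lp (2 ^ P) * s ≤ t / 2 := by
        calc _ ≤ h₀ * s := by gcongr; exact le_max_right _ _
          _ = t / 2 := by rw [hts]; ring
      calc rieszPotential Ω α f x
          ≤ rieszPotential Ω α (largePart f) x + ENNReal.ofReal (kernelConst n a (diam Ω)) :=
            H.rieszPotential_le_add hb (enorm_le_enorm_largePart_add_one f) hx
        _ ≤ ENNReal.ofReal (t / 2) + ENNReal.ofReal (t / 2) := by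
            gcongr
            · exact hle.trans (ENNReal.ofReal_le_ofReal h1)
            · linarith
        _ = ENNReal.ofReal t := by
            rw [← ENNReal.ofReal_add (by positivity) (by positivity), add_halves]
    have hpt : ∀ x ∈ Ω, ENNReal.ofReal (t ^ sharpExponent α p x)
        ≤ ENNReal.ofReal ((2 * h₀) ^ Q) * ENNReal.ofReal (s ^ sharpExponent α p x) := by
      intro x hx
      rw [← ENNReal.ofReal_mul (by positivity)]
      refine ENNReal.ofReal_le_ofReal ?_
      rw [hts, Real.mul_rpow (by positivity) (by positivity)]
      gcongr
      · linarith
      · exact H.sharpExponent_le hx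
    have hSΩ : ∀ᵐ x ∂(volume.restrict S), x ∈ Ω :=
      ae_mono (Measure.restrict_mono (fun x hx => hx.1) le_rfl)
        (ae_restrict_mem H.measurableSet)
    calc _ ≤ ∫⁻ x in S, ENNReal.ofReal (t ^ sharpExponent α p x) := lintegral_mono_set hsub
      _ ≤ ∫⁻ x in S, ENNReal.ofReal ((2 * h₀) ^ Q) * ENNReal.ofReal (s ^ sharpExponent α p x) :=
          lintegral_mono_ae (hSΩ.mono hpt)
      _ = ENNReal.ofReal ((2 * h₀) ^ Q) * ∫⁻ x in S, ENNReal.ofReal (s ^ sharpExponent α p x) :=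
          lintegral_const_mul' _ _ ENNReal.ofReal_ne_top
      _ ≤ ENNReal.ofReal ((2 * h₀) ^ Q)
          * (ENNReal.ofReal (weakConst n b P Lp Lα (2 ^ P)) * modular Ω p f) := by
          gcongr
          refine (H.setLIntegral_rpow_sharpExponent_le (largePart_eq_zero_or_one_le f) hφm hK
            (hφmod.trans hmod) hs1).trans ?_
          gcongr
      _ ≤ _ := by
          rw [← mul_assoc, ← ENNReal.ofReal_mul (by positivity)]
          gcongr
          · exact le_max_right _ _
          · exact le_self_add

theorem exponentBounds_of_essSup {n : ℕ} (hn : 2 ≤ n) {Ω : Set (EuclideanSpace ℝ (Fin n))}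
    (hΩ : IsOpen Ω) (hne : Ω.Nonempty) {p α : EuclideanSpace ℝ (Fin n) → ℝ} {Lp Lα : ℝ}
    (hp : IsVariableExponent Ω p) (hLp : LogHolderOnWith Lp Ω p) (hLα : LogHolderOnWith Lα Ω α)
    (hα : 0 < essInfOn Ω α)
    (hαp : essSupOn Ω (fun x => α x * p x) < ((n : ℝ) : EReal)) :
    ExponentBounds Ω p α (essInfOn Ω α).toReal (essSupOn Ω (fun x => α x * p x)).toReal
      (essSupOn Ω p).toReal Lp Lα := by
  have : NeZero ((volume : Measure (EuclideanSpace ℝ (Fin n))).restrict Ω) :=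
    ⟨fun h => (hΩ.measure_pos volume hne).ne' (Measure.restrict_eq_zero.1 h)⟩
  have hαtop : essInfOn Ω α ≠ ⊤ := by
    obtain ⟨y, hy⟩ := (ae_essInf_le (f := fun y => (α y : EReal))
      (μ := volume.restrict Ω)).exists
    exact (hy.trans_lt (EReal.coe_lt_top _)).ne
  have hbot : essInfOn Ω α ≠ ⊥ := (bot_lt_of_lt hα).ne'
  have hn0 : (0 : ℝ) < n := by positivity
  refine
    { two_le := hn
      measurableSet := hΩ.measurableSet
      one_le := hp.one_le
      le_P := fun x hx => le_of_essSup_le hΩ hLp.continuousOn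
        (EReal.le_coe_toReal hp.essSup_lt_top.ne) hx
      a_pos := EReal.toReal_pos hα hαtop
      a_le := fun x hx => le_of_le_essInf hΩ hLα.continuousOn (EReal.coe_toReal_le hbot) hx
      mul_le := fun x hx => le_of_essSup_le hΩ (hLα.continuousOn.mul hLp.continuousOn)
        (EReal.le_coe_toReal (ne_top_of_lt hαp)) hx
      b_lt := ?_
      logHolder_p := hLp
      logHolder_α := hLα }
  -- In the case `⊥` the default value `0` of `toReal` still lies below `n`.
  rcases eq_or_ne (essSupOn Ω fun x => α x * p x) ⊥ with h | h
  · rwa [h, EReal.toReal_bot]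
  · rwa [← EReal.coe_lt_coe_iff, EReal.coe_toReal (ne_top_of_lt hαp) h]

end VariableExponent

theorem mainTheorem4 :
    -- `C n (diam Ω) α⁻ (αp)⁺ p⁺ Lp Lα` is the constant
    ∃ C : ℕ → ℝ → EReal → EReal → EReal → ℝ → ℝ → ℝ≥0,
      ∀ (n : ℕ), 2 ≤ n →
      ∀ (Ω : Set (EuclideanSpace ℝ (Fin n))), IsOpen Ω → Bornology.IsBounded Ω →
      ∀ (p α : EuclideanSpace ℝ (Fin n) → ℝ) (Lp Lα : ℝ),
        IsVariableExponent Ω p → LogHolderOnWith Lp Ω p → LogHolderOnWith Lα Ω α →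
        0 < essInfOn Ω α → essSupOn Ω (fun x => α x * p x) < ((n : ℝ) : EReal) →
      ∀ (f : EuclideanSpace ℝ (Fin n) → ℝ), MemVarLp Ω p f → luxemburgNorm Ω p f ≤ 1 →
      ∀ (t : ℝ), 0 < t →
        ∫⁻ x in {x | x ∈ Ω ∧ ENNReal.ofReal t < rieszPotential Ω α f x},
            ENNReal.ofReal (t ^ sharpExponent α p x)
          ≤ (C n (Metric.diam Ω) (essInfOn Ω α) (essSupOn Ω (fun x => α x * p x))
                (essSupOn Ω p) Lp Lα : ℝ≥0∞) * modular Ω p f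
            + (C n (Metric.diam Ω) (essInfOn Ω α) (essSupOn Ω (fun x => α x * p x))
                (essSupOn Ω p) Lp Lα : ℝ≥0∞) * volume {x | x ∈ Ω ∧ 0 < |f x| ∧ |f x| ≤ 1} := by
  refine ⟨fun n d a b P Lp Lα =>
    (rieszWeakTypeConst n d a.toReal b.toReal P.toReal Lp Lα).toNNReal, ?_⟩
  intro n hn Ω hΩ hb p α Lp Lα hp hLp hLα hα hαp f hf hnorm t ht
  -- On the empty set the essential bounds are degenerate, but the integral on the left vanishes.
  rcases Ω.eq_empty_or_nonempty with rfl | hne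
  · simp
  · have H := exponentBounds_of_essSup hn hΩ hne hp hLp hLα hα hαp
    rw [← mul_add]
    exact H.weak_type hb hp.aemeasurable hf.1 hne
      (modular_le_of_luxemburgNorm_le_one H.measurableSet
        (fun x hx => zero_le_one.trans (H.one_le x hx)) H.le_P hnorm) ht
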